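/- Let $n\ge 1$. A nonconstant polynomial $f\in\mathbb R[\mathbf x]=\mathbb R[x_1,\dots,x_n]$ is called SPLD (separable plus lower degree) if $f=s+l$, where $s(\mathbf x)=\sum_{j=1}^n u_j(x_j)$ for some univariate polynomials $u_j$ and $l\in\mathbb R[\mathbf x]$ has $\deg l<\deg s$. Let $f_0,f_1,\dots,f_m$ be SPLD polynomials, put $$\mathbf K=\{\mathbf x\in\mathbb R^n: 0\le f_i(\mathbf x)\le 1,\ i=1,\dots,m\},\qquad \mathrm{val}(P)=\inf\{f_0(\mathbf x):\mathbf x\in\mathbf K\},$$ and for $k\in\mathbb N=\{0,1,2,\dots\}$ let $N_k=\{(\mathbf p,\mathbf q)\in\mathbb N^m\times\mathbb N^m: |\mathbf p|+|\mathbf q|\le k\}$ and $h_{\mathbf p,\mathbf q}=\prod_{i=1}^m f_i^{p_i}(1-f_i)^{q_i}$. Fix $\mathbf d=(d_1,\dots,d_n)\in\mathbb N^n$ and $r\in\mathbb N$. Let $\Sigma[\mathbf x]_r$ be the set of sums of squares of polynomials in $\mathbf x$ having degree at most $2r$, and $\Sigma[x_j]_{d_j}$ the set of sums of squares of univariate polynomials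 in $x_j$ having degree at most $2d_j$. The value of the $k$-th SOS relaxation is $$\mathrm{val}(D_k^{\mathbf d,r})=\sup\Big\{\mu\in\mathbb R:\ f_0-\sum_{(\mathbf p,\mathbf q)\in N_k}c_{\mathbf p,\mathbf q}h_{\mathbf p,\mathbf q}-\mu=\sigma+\sum_{j=1}^n\sigma_j,\ c_{\mathbf p,\mathbf q}\ge 0,\ \sigma\in\Sigma[\mathbf x]_r,\ \sigma_j\in\Sigma[x_j]_{d_j}\Big\}.$$ Let $d_{\max}=d_{\max}(k)$ be the smallest positive integer with $2d_{\max}\ge\max\{\deg f_0,\ k\max_{1\le i\le m}\deg f_i\}$, and let $D=D(k)=\max\{d_{\max},r,d_1,\dots,d_n\}$. Write $\mathbb N^n_{e}=\{\alpha\in\mathbb N^n:|\alpha|\le e\}$, let $g_\alpha$ be the coefficient of $\mathbf x^\alpha$ in $g$ (entrywise for polynomial matrices), and let $\lceil\mathbf x\rceil_r=(\mathbf x^\alpha)_{\alpha\in\mathbb N^n_r}$ and $\lceil x_j\rceil_{d_j}=(1,x_j,\dots,x_j^{d_j})^T$. The value $\mathrm{val}(\widetilde D_k^{\mathbf d,r})$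 of the $k$-th moment relaxation is the infimum of $\sum_{\alpha\in\mathbb N^n_{2D}}(f_0)_\alpha y_\alpha$ over all $\mathbf y=(y_\alpha)_{\alpha\in\mathbb N^n_{2D}}$ with real entries such that $y_{\mathbf 0}=1$, $$\sum_{\alpha\in\mathbb N^n_{2D}}(h_{\mathbf p,\mathbf q})_\alpha y_\alpha\ge0\quad\text{for all }(\mathbf p,\mathbf q)\in N_k,$$ and the matrices $\sum_{\alpha\in\mathbb N^n_{2D}}y_\alpha(\lceil x_j\rceil_{d_j}\lceil x_j\rceil_{d_j}^T)_\alpha$, $j=1,\dots,n$, and $\sum_{\alpha\in\mathbb N^n_{2D}}y_\alpha(\lceil\mathbf x\rceil_r\lceil\mathbf x\rceil_r^T)_\alpha$ are positive semidefinite. Suprema and infima are taken in $[-\infty,+\infty]$, with $\sup\emptyset=-\infty$ and $\inf\emptyset=+\infty$. Assume that $\mathbf K$ is nonempty and compact and that $\{1,f_1,\dots,f_m\}$ generates $\mathbb R[\mathbf x]$ as an $\mathbb R$-algebra. Then $$\mathrm{val}(D_k^{\mathbf d,r})\le\mathrm{val}(\widetilde D_k^{\mathbf d,r})\le\mathrm{val}(P)\quad\text{for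 all }k\in\mathbb N,$$ and $$\lim_{k\to\infty}\mathrm{val}(D_k^{\mathbf d,r})=\lim_{k\to\infty}\mathrm{val}(\widetilde D_k^{\mathbf d,r})=\mathrm{val}(P).$$ -/

import Mathlib

open MvPolynomial Filter Topology

noncomputable section

namespace SPLD

/-- A polynomial `s` in `n` variables is separable if `s(x) = u₁(x₁) + ⋯ + uₙ(xₙ)` for some
univariate polynomials `uⱼ`. -/
def IsSeparablePoly {n : ℕ} (s : MvPolynomial (Fin n) ℝ) : Prop :=
  ∃ u : Fin n → Polynomial ℝ, s = ∑ j, Polynomial.aeval (X j : MvPolynomial (Fin n) ℝ) (u j)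

/-- Separable plus lower degree polynomials: nonconstant polynomials `s + l` with `s` separable
and `deg l < deg s`. -/
def IsSPLD {n : ℕ} (f : MvPolynomial (Fin n) ℝ) : Prop :=
  (∀ a : ℝ, f ≠ C a) ∧
    ∃ s l : MvPolynomial (Fin n) ℝ,
      IsSeparablePoly s ∧ l.totalDegree < s.totalDegree ∧ f = s + l

/-- The feasible set `K = {x ∈ ℝⁿ : 0 ≤ fᵢ(x) ≤ 1, i = 1, …, m}`. -/
def feasibleSet {n m : ℕ} (f : Fin m → MvPolynomial (Fin n) ℝ) : Set (Fin n → ℝ) :=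
  {x | ∀ i, 0 ≤ eval x (f i) ∧ eval x (f i) ≤ 1}

/-- The optimal value of `inf {f₀(x) : x ∈ K}`. -/
def valP {n m : ℕ} (f₀ : MvPolynomial (Fin n) ℝ) (f : Fin m → MvPolynomial (Fin n) ℝ) : EReal :=
  ⨅ x ∈ feasibleSet f, ((eval x f₀ : ℝ) : EReal)

/-- The index set `N_k = {(p, q) ∈ ℕᵐ × ℕᵐ : |p| + |q| ≤ k}`. -/
def indexN (m k : ℕ) : Finset ((Fin m → ℕ) × (Fin m → ℕ)) :=
  ((Fintype.piFinset fun _ => Finset.range (k + 1)) ×ˢ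
    (Fintype.piFinset fun _ => Finset.range (k + 1))).filter
      fun pq => ∑ i, pq.1 i + ∑ i, pq.2 i ≤ k

theorem mem_indexN {m k : ℕ} (pq : (Fin m → ℕ) × (Fin m → ℕ)) :
    pq ∈ indexN m k ↔ ∑ i, pq.1 i + ∑ i, pq.2 i ≤ k := by
  simp only [indexN, Finset.mem_filter, Finset.mem_product, Fintype.mem_piFinset,
    Finset.mem_range, and_iff_right_iff_imp]
  intro h
  constructor <;> intro i
  · have := Finset.single_le_sum (f := pq.1) (fun _ _ => Nat.zero_le _) (Finset.mem_univ i)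
    omega
  · have := Finset.single_le_sum (f := pq.2) (fun _ _ => Nat.zero_le _) (Finset.mem_univ i)
    omega

/-- The polynomial `h_{p,q} = ∏ᵢ fᵢ^{pᵢ} (1 - fᵢ)^{qᵢ}`. -/
def hPoly {n m : ℕ} (f : Fin m → MvPolynomial (Fin n) ℝ)
    (pq : (Fin m → ℕ) × (Fin m → ℕ)) : MvPolynomial (Fin n) ℝ :=
  ∏ i, f i ^ pq.1 i * (1 - f i) ^ pq.2 i

/-- `Σ[x]_r`: sums of squares of degree at most `2r` in all the variables. -/
def sosSet (n r : ℕ) : Set (MvPolynomial (Fin n) ℝ) :=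
  {σ | IsSumSq σ ∧ σ.totalDegree ≤ 2 * r}

/-- Univariate sums of squares of degree at most `2d`. -/
def sosSetUni (d : ℕ) : Set (Polynomial ℝ) :=
  {σ | IsSumSq σ ∧ σ.natDegree ≤ 2 * d}

/-- The real `μ` is feasible for the SOS relaxation of order `k`: there are `c_{p,q} ≥ 0`,
`σ ∈ Σ[x]_r` and `σⱼ ∈ Σ[xⱼ]_{dⱼ}` with `f₀ - ∑ c_{p,q} h_{p,q} - μ = σ + ∑ⱼ σⱼ`. -/
def IsFeasibleSOS {n m : ℕ} (f₀ : MvPolynomial (Fin n) ℝ) (f : Fin m → MvPolynomial (Fin n) ℝ)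
    (d : Fin n → ℕ) (r k : ℕ) (μ : ℝ) : Prop :=
  ∃ (c : (Fin m → ℕ) × (Fin m → ℕ) → ℝ) (σ : MvPolynomial (Fin n) ℝ) (τ : Fin n → Polynomial ℝ),
    (∀ pq ∈ indexN m k, 0 ≤ c pq) ∧ σ ∈ sosSet n r ∧ (∀ j, τ j ∈ sosSetUni (d j)) ∧
      f₀ - ∑ pq ∈ indexN m k, C (c pq) * hPoly f pq - C μ =
        σ + ∑ j, Polynomial.aeval (X j : MvPolynomial (Fin n) ℝ) (τ j)

/-- The optimal value of the SOS relaxation of order `k` (a supremum in the extended reals,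
`⊥` if the relaxation is infeasible). -/
def valSOS {n m : ℕ} (f₀ : MvPolynomial (Fin n) ℝ) (f : Fin m → MvPolynomial (Fin n) ℝ)
    (d : Fin n → ℕ) (r k : ℕ) : EReal :=
  ⨆ μ ∈ {μ : ℝ | IsFeasibleSOS f₀ f d r k μ}, (μ : EReal)

/-- The set `ℕⁿ_D` of multi-indices `α` with `|α| ≤ D`. -/
def multiIndices (n D : ℕ) : Finset (Fin n →₀ ℕ) :=
  (Finset.range (D + 1)).biUnion fun t => Finset.univ.finsuppAntidiag t

theorem mem_multiIndices {n D : ℕ} (α : Fin n →₀ ℕ) : α ∈ multiIndices n D ↔ ∑ j, α j ≤ D := by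
  simp [multiIndices, Finset.mem_finsuppAntidiag]

/-- The smallest positive integer `e` such that
`2e ≥ max {deg f₀, k * max {deg f₁, …, deg f_m}}`. -/
def dMax {n m : ℕ} (f₀ : MvPolynomial (Fin n) ℝ) (f : Fin m → MvPolynomial (Fin n) ℝ)
    (k : ℕ) : ℕ :=
  sInf {e : ℕ | 0 < e ∧
    max f₀.totalDegree (k * Finset.univ.sup fun i => (f i).totalDegree) ≤ 2 * e}

/-- The order to which moments are kept in the moment relaxation: `max {d_max, r, d₁, …, dₙ}`, so
that every monomial in the data and in the moment matrices has a corresponding variable `y_α`. -/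
def truncOrder {n m : ℕ} (f₀ : MvPolynomial (Fin n) ℝ) (f : Fin m → MvPolynomial (Fin n) ℝ)
    (d : Fin n → ℕ) (r k : ℕ) : ℕ :=
  max (dMax f₀ f k) (max r (Finset.univ.sup d))

/-- `∑_{α ∈ ℕⁿ_D} g_α y_α`. -/
def riesz {n D : ℕ} (y : multiIndices n D → ℝ) (g : MvPolynomial (Fin n) ℝ) : ℝ :=
  ∑ α : multiIndices n D, coeff α.1 g * y α

/-- For a vector `v` of polynomials, the matrix `∑_{α ∈ ℕⁿ_D} y_α (v vᵀ)_α`, where `(v vᵀ)_α` is the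
matrix of the coefficients of `x^α` in the entries of `v vᵀ`. -/
def momentMatrix {n D : ℕ} {ι : Type} (y : multiIndices n D → ℝ)
    (v : ι → MvPolynomial (Fin n) ℝ) : Matrix ι ι ℝ :=
  ∑ α : multiIndices n D, y α • Matrix.of fun a b => coeff α.1 (v a * v b)

/-- The vector of all monomials of degree at most `r`. -/
def monomialVec (n r : ℕ) : multiIndices n r → MvPolynomial (Fin n) ℝ :=
  fun β => monomial β.1 1

/-- The vector `(1, xⱼ, …, xⱼᵉ)`. -/
def monomialVecUni {n : ℕ} (j : Fin n) (e : ℕ) : Fin (e + 1) → MvPolynomial (Fin n) ℝ :=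
  fun a => X j ^ (a : ℕ)

/-- Feasibility of `y` for the moment relaxation of order `k`. -/
structure IsFeasibleMoment {n m : ℕ} (f : Fin m → MvPolynomial (Fin n) ℝ)
    (d : Fin n → ℕ) (r k : ℕ) {D : ℕ} (y : multiIndices n D → ℝ) : Prop where
  riesz_nonneg : ∀ pq ∈ indexN m k, 0 ≤ riesz y (hPoly f pq)
  posSemidef_uni : ∀ j, (momentMatrix y (monomialVecUni j (d j))).PosSemidef
  posSemidef : (momentMatrix y (monomialVec n r)).PosSemidef
  normalized : ∀ α : multiIndices n D, α.1 = 0 → y α = 1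

/-- The optimal value of the moment relaxation of order `k` (an infimum in the extended reals,
`⊤` if the relaxation is infeasible). -/
def valMoment {n m : ℕ} (f₀ : MvPolynomial (Fin n) ℝ) (f : Fin m → MvPolynomial (Fin n) ℝ)
    (d : Fin n → ℕ) (r k : ℕ) : EReal :=
  ⨅ y ∈ {y : multiIndices n (2 * truncOrder f₀ f d r k) → ℝ | IsFeasibleMoment f d r k y},
    ((riesz y f₀ : ℝ) : EReal)

end SPLD

end

/-! The inequalities are weak duality: the functional of a feasible `y` turns an SOS certificate
into μ ≤ ∑ (f₀)_α y_α, and the moments of a point of K are feasible with value f₀(x).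

Convergence rests on Krivine's theorem `SPLD.exists_mem_handelmanCone`, with all squares set to
zero. The substitution yᵢ ↦ fᵢ maps ℝ[y₁,…,yₘ] onto ℝ[x], and the zeros of its kernel in the cube
[0,1]ᵐ correspond to K. A polynomial positive on K therefore lifts to one positive on those zeros.
Adding an element of the kernel makes the lift positive on the whole cube
(`SPLD.exists_mem_ideal_add_pos`). By Bernstein's theorem its Bernstein coefficients of high degree
are then nonnegative, and substituting the fᵢ back gives a nonnegative combination of the h_{p,q}.
For real μ < val(P), this applies to f₀ - μ. -/

/-! ### Bernstein expansions on the cube. -/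

/-- Monomials in the Bernstein basis of degree `N`. -/
theorem pow_eq_sum_bernstein {A : Type*} [CommRing A] [Algebra ℝ A] (t : A) {a N : ℕ} (h : a ≤ N) :
    t ^ a = ∑ k ∈ Finset.range (N + 1),
      algebraMap ℝ A ((k.choose a : ℝ) / (N.choose a : ℝ) * (N.choose k : ℝ)) *
        (t ^ k * (1 - t) ^ (N - k)) := by
  obtain ⟨b, rfl⟩ := Nat.exists_eq_add_of_le h
  -- The binomial expansion of this factor 1 yields the terms with k ≥ a; those with k < a vanish
  -- because C(k, a) = 0.
  have h1 : t ^ a = t ^ a * (t + (1 - t)) ^ b := by simp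
  rw [h1, add_pow, Finset.mul_sum, add_assoc a b 1, Finset.sum_range_add _ a (b + 1),
    Finset.sum_eq_zero (s := Finset.range a), zero_add]
  · refine Finset.sum_congr rfl fun j hj => ?_
    have hj : j ≤ b := Nat.lt_succ_iff.mp (Finset.mem_range.mp hj)
    have hc : ((a + b).choose (a + j) * (a + j).choose a : ℝ) = (a + b).choose a * b.choose j := by
      have := Nat.choose_mul (n := a + b) (k := a + j) (s := a) (by omega)
      rw [Nat.add_sub_cancel_left, Nat.add_sub_cancel_left] at this
      exact_mod_cast this
    have hne : ((a + b).choose a : ℝ) ≠ 0 := by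
      exact_mod_cast (Nat.choose_pos (Nat.le_add_right a b)).ne'
    have : ((a + j).choose a : ℝ) / ((a + b).choose a) * ((a + b).choose (a + j)) = b.choose j := by
      field_simp
      linarith
    rw [this, map_natCast, show a + b - (a + j) = b - j by omega, pow_add]
    ring
  · intro k hk
    rw [Nat.choose_eq_zero_of_lt (Finset.mem_range.mp hk)]
    simp

theorem choose_div_choose_mem_Icc (a : ℕ) {k N : ℕ} (h : k ≤ N) :
    (k.choose a : ℝ) / (N.choose a : ℝ) ∈ Set.Icc (0 : ℝ) 1 :=
  ⟨by positivity, div_le_one_of_le₀ (by exact_mod_cast Nat.choose_le_choose a h) (by positivity)⟩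

theorem choose_succ_div_choose_succ (k N a : ℕ) (h : a < N) :
    (k.choose (a + 1) : ℝ) / (N.choose (a + 1) : ℝ) =
      (k.choose a : ℝ) / (N.choose a : ℝ) * (((k : ℝ) - a) / (N - a)) := by
  have key : ∀ q : ℕ, (q.choose (a + 1) : ℝ) * (a + 1) = q.choose a * ((q : ℝ) - a) := by
    intro q
    rcases le_or_gt a q with hq | hq
    · have := Nat.choose_succ_right_eq q a
      rw [← Nat.cast_sub hq]
      exact_mod_cast this
    · rw [Nat.choose_eq_zero_of_lt hq, Nat.choose_eq_zero_of_lt (by omega)]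
      simp
  have hk := key k
  have hN := key N
  have h1 : (N.choose (a + 1) : ℝ) ≠ 0 := by exact_mod_cast (Nat.choose_pos h).ne'
  have h2 : (N.choose a : ℝ) ≠ 0 := by exact_mod_cast (Nat.choose_pos h.le).ne'
  have h3 : (N : ℝ) - a ≠ 0 := sub_ne_zero.mpr (by exact_mod_cast h.ne')
  have h4 : (a : ℝ) + 1 ≠ 0 := by positivity
  rw [div_mul_div_comm, div_eq_div_iff h1 (mul_ne_zero h2 h3), ← hN, ← hk]
  ring

/-- Raising a by one multiplies the ratio by (k - a)/(N - a) and the power by k/N. Both factors have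
absolute value at most 1 and they differ by at most 2a/N, so the errors add up. -/
theorem exists_abs_choose_div_choose_sub_pow_le (a : ℕ) :
    ∃ c : ℝ, 0 ≤ c ∧ ∀ N : ℕ, 2 * a < N → ∀ k ≤ N,
      |(k.choose a : ℝ) / (N.choose a : ℝ) - ((k : ℝ) / N) ^ a| ≤ c / N := by
  induction a with
  | zero => exact ⟨0, le_rfl, fun N _ k _ => by simp⟩
  | succ a ih =>
    obtain ⟨c, hc, ih⟩ := ih
    refine ⟨c + 2 * a, by positivity, fun N hN k hk => ?_⟩
    have h0 := ih N (by omega) k hk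
    have hNR : 2 * ((a : ℝ) + 1) < N := by exact_mod_cast hN
    have hkR : (k : ℝ) ≤ N := by exact_mod_cast hk
    have hk0 : (0 : ℝ) ≤ k := k.cast_nonneg
    have ha0 : (0 : ℝ) ≤ a := a.cast_nonneg
    have hN0 : (0 : ℝ) < N := by linarith
    have hNa : (0 : ℝ) < N - a := by linarith
    rw [choose_succ_div_choose_succ k N a (by omega), pow_succ]
    set x : ℝ := (k : ℝ) / N with hx
    set s : ℝ := ((k : ℝ) - a) / (N - a) with hs
    set R := (k.choose a : ℝ) / (N.choose a : ℝ)
    have hx0 : 0 ≤ x := by positivity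
    have hx1 : x ≤ 1 := div_le_one_of_le₀ hkR hN0.le
    have hs1 : |s| ≤ 1 := by
      rw [hs, abs_div, abs_of_pos hNa, div_le_one hNa, abs_le]
      constructor <;> linarith
    have hsx : |s - x| ≤ 2 * a / N := by
      have : s - x = -(a * (N - k) / (N * (N - a))) := by
        rw [hs, hx]; field_simp; ring
      rw [this, abs_neg, abs_of_nonneg (div_nonneg (mul_nonneg ha0 (by linarith)) (by positivity)),
        div_le_div_iff₀ (by positivity) hN0]
      have : (a : ℝ) * (N - k) ≤ 2 * a * (N - a) := by nlinarith
      nlinarith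
    have hxa : x ^ a ≤ 1 := pow_le_one₀ hx0 hx1
    have hxa0 : 0 ≤ x ^ a := by positivity
    calc |R * s - x ^ a * x| = |(R - x ^ a) * s + x ^ a * (s - x)| := by ring_nf
      _ ≤ |R - x ^ a| * |s| + x ^ a * |s - x| := by
        refine (abs_add_le _ _).trans ?_
        rw [abs_mul, abs_mul, abs_of_nonneg hxa0]
      _ ≤ c / N * 1 + 1 * (2 * a / N) := by gcongr
      _ = (c + 2 * a) / N := by ring

theorem abs_prod_sub_prod_le_sum {ι : Type*} (s : Finset ι) (u v : ι → ℝ)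
    (hu : ∀ i ∈ s, u i ∈ Set.Icc (0 : ℝ) 1) (hv : ∀ i ∈ s, v i ∈ Set.Icc (0 : ℝ) 1) :
    |∏ i ∈ s, u i - ∏ i ∈ s, v i| ≤ ∑ i ∈ s, |u i - v i| := by
  classical
  induction s using Finset.induction_on with
  | empty => simp
  | insert i s hi ih =>
    rw [Finset.prod_insert hi, Finset.prod_insert hi, Finset.sum_insert hi]
    have ih := ih (fun j hj => hu j (Finset.mem_insert_of_mem hj))
      (fun j hj => hv j (Finset.mem_insert_of_mem hj))
    have hui := hu i (Finset.mem_insert_self i s)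
    have hP0 : 0 ≤ ∏ j ∈ s, v j :=
      Finset.prod_nonneg fun j hj => (hv j (Finset.mem_insert_of_mem hj)).1
    have hP1 : ∏ j ∈ s, v j ≤ 1 :=
      Finset.prod_le_one (fun j hj => (hv j (Finset.mem_insert_of_mem hj)).1)
        fun j hj => (hv j (Finset.mem_insert_of_mem hj)).2
    calc |u i * ∏ j ∈ s, u j - v i * ∏ j ∈ s, v j|
        = |(u i - v i) * ∏ j ∈ s, v j + u i * (∏ j ∈ s, u j - ∏ j ∈ s, v j)| := by ring_nf
      _ ≤ |u i - v i| * ∏ j ∈ s, v j + u i * |∏ j ∈ s, u j - ∏ j ∈ s, v j| := by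
        refine (abs_add_le _ _).trans ?_
        rw [abs_mul, abs_mul, abs_of_nonneg hP0, abs_of_nonneg hui.1]
      _ ≤ |u i - v i| * 1 + 1 * ∑ j ∈ s, |u j - v j| := by
        gcongr
        exact hui.2
      _ = _ := by ring

/-- The coefficient of a polynomial at the product Bernstein monomial `κ` of degree `N`, up to
binomial factors. -/
noncomputable def bernsteinCoeff {m : ℕ} (F : MvPolynomial (Fin m) ℝ) (N : ℕ) (κ : Fin m → ℕ) : ℝ :=
  ∑ α ∈ F.support, coeff α F * ∏ i, ((κ i).choose (α i) : ℝ) / (N.choose (α i) : ℝ)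

theorem exists_abs_bernsteinCoeff_sub_eval_le {m : ℕ} (F : MvPolynomial (Fin m) ℝ) :
    ∃ c : ℝ, ∀ᶠ N : ℕ in atTop, ∀ κ : Fin m → ℕ, (∀ i, κ i ≤ N) →
      |bernsteinCoeff F N κ - eval (fun i => (κ i : ℝ) / N) F| ≤ c / N := by
  choose c hc0 hc using exists_abs_choose_div_choose_sub_pow_le
  refine ⟨∑ α ∈ F.support, |coeff α F| * ∑ i, c (α i), ?_⟩
  filter_upwards [eventually_gt_atTop (2 * F.totalDegree)] with N hN κ hκ
  rw [bernsteinCoeff, eval_eq', ← Finset.sum_sub_distrib, Finset.sum_div]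
  refine (Finset.abs_sum_le_sum_abs _ _).trans (Finset.sum_le_sum fun α hα => ?_)
  rw [← mul_sub, abs_mul, mul_div_assoc, Finset.sum_div]
  refine mul_le_mul_of_nonneg_left ?_ (abs_nonneg _)
  refine (abs_prod_sub_prod_le_sum _ _ _ (fun i _ => choose_div_choose_mem_Icc _ (hκ i))
    fun i _ => ?_).trans (Finset.sum_le_sum fun i _ => hc _ N ?_ _ (hκ i))
  · have : (κ i : ℝ) / N ≤ 1 := div_le_one_of_le₀ (by exact_mod_cast hκ i) (by positivity)
    exact ⟨by positivity, pow_le_one₀ (by positivity) this⟩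
  · have h1 : α i ≤ F.degreeOf i := monomial_le_degreeOf i hα
    have h2 := degreeOf_le_totalDegree F i
    omega

/-- The coefficient at κ is within c/N of the value of F at the grid point κ/N, and c/N eventually
drops below the positive minimum of F on the cube. -/
theorem eventually_forall_bernsteinCoeff_nonneg {m : ℕ} (F : MvPolynomial (Fin m) ℝ)
    (hF : ∀ y ∈ Set.Icc (0 : Fin m → ℝ) 1, 0 < eval y F) :
    ∀ᶠ N : ℕ in atTop, ∀ κ : Fin m → ℕ, (∀ i, κ i ≤ N) → 0 ≤ bernsteinCoeff F N κ := by
  obtain ⟨y₀, hy₀, hmin⟩ := (isCompact_Icc (a := (0 : Fin m → ℝ)) (b := 1)).exists_isMinOn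
    ⟨0, le_rfl, fun _ => zero_le_one⟩ (MvPolynomial.continuous_eval F).continuousOn
  obtain ⟨c, hc⟩ := exists_abs_bernsteinCoeff_sub_eval_le F
  have hlim := (tendsto_const_div_atTop_nhds_zero_nat c).eventually_lt_const (hF y₀ hy₀)
  filter_upwards [hc, hlim] with N h1 h2 κ hκ
  have h3 := (abs_le.mp (h1 κ hκ)).1
  have h4 : eval y₀ F ≤ eval (fun i => (κ i : ℝ) / N) F :=
    hmin ⟨fun i => by simp only [Pi.zero_apply]; positivity,
      fun i => div_le_one_of_le₀ (Nat.cast_le.mpr (hκ i)) N.cast_nonneg⟩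
  linarith

/-- The one-variable expansions are multiplied out monomial by monomial. Allowing any algebra `A`
lets the fᵢ themselves be substituted. -/
theorem aeval_eq_sum_bernsteinCoeff {m : ℕ} {A : Type*} [CommRing A] [Algebra ℝ A] (f : Fin m → A)
    (F : MvPolynomial (Fin m) ℝ) {N : ℕ} (hN : F.totalDegree ≤ N) :
    aeval f F = ∑ κ ∈ Fintype.piFinset fun _ : Fin m => Finset.range (N + 1),
      algebraMap ℝ A (bernsteinCoeff F N κ * ∏ i, (N.choose (κ i) : ℝ)) *
        ∏ i, (f i ^ κ i * (1 - f i) ^ (N - κ i)) := by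
  have key : ∀ α ∈ F.support, algebraMap ℝ A (coeff α F) * ∏ i, f i ^ α i =
      ∑ κ ∈ Fintype.piFinset fun _ : Fin m => Finset.range (N + 1),
        algebraMap ℝ A (coeff α F * (∏ i, ((κ i).choose (α i) : ℝ) / (N.choose (α i) : ℝ)) *
          ∏ i, (N.choose (κ i) : ℝ)) * ∏ i, (f i ^ κ i * (1 - f i) ^ (N - κ i)) := by
    intro α hα
    have : ∏ i, f i ^ α i = ∏ i, ∑ k ∈ Finset.range (N + 1),
        algebraMap ℝ A ((k.choose (α i) : ℝ) / (N.choose (α i) : ℝ) * (N.choose k : ℝ)) *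
        (f i ^ k * (1 - f i) ^ (N - k)) :=
      Finset.prod_congr rfl fun i _ => pow_eq_sum_bernstein _
        (((monomial_le_degreeOf i hα).trans (degreeOf_le_totalDegree F i)).trans hN)
    rw [this, Finset.prod_univ_sum, Finset.mul_sum]
    refine Finset.sum_congr rfl fun κ _ => ?_
    rw [Finset.prod_mul_distrib, ← map_prod, Finset.prod_mul_distrib, ← mul_assoc, ← map_mul,
      ← mul_assoc]
  rw [aeval_def, eval₂_eq', Finset.sum_congr rfl key, Finset.sum_comm]
  refine Finset.sum_congr rfl fun κ _ => ?_
  rw [bernsteinCoeff, Finset.sum_mul, map_sum, Finset.sum_mul]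

/-! ### The cone generated by the h_{p,q} and Krivine's theorem. -/

namespace SPLD

variable {n m : ℕ}

/-- Nonnegative combinations of the polynomials `h_{p,q}` with `(p, q) ∈ N_k`. -/
def handelmanCone (f : Fin m → MvPolynomial (Fin n) ℝ) (k : ℕ) : Set (MvPolynomial (Fin n) ℝ) :=
  {g | ∃ c : (Fin m → ℕ) × (Fin m → ℕ) → ℝ, (∀ pq ∈ indexN m k, 0 ≤ c pq) ∧
    g = ∑ pq ∈ indexN m k, C (c pq) * hPoly f pq}

theorem zero_mem_handelmanCone (f : Fin m → MvPolynomial (Fin n) ℝ) (k : ℕ) :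
    0 ∈ handelmanCone f k :=
  ⟨0, fun _ _ => le_rfl, by simp⟩

theorem add_mem_handelmanCone {f : Fin m → MvPolynomial (Fin n) ℝ} {k : ℕ}
    {g h : MvPolynomial (Fin n) ℝ} (hg : g ∈ handelmanCone f k) (hh : h ∈ handelmanCone f k) :
    g + h ∈ handelmanCone f k := by
  obtain ⟨c, hc, rfl⟩ := hg
  obtain ⟨e, he, rfl⟩ := hh
  refine ⟨c + e, fun pq hpq => add_nonneg (hc pq hpq) (he pq hpq), ?_⟩
  rw [← Finset.sum_add_distrib]
  exact Finset.sum_congr rfl fun pq _ => by rw [Pi.add_apply, C_add, add_mul]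

theorem sum_mem_handelmanCone {f : Fin m → MvPolynomial (Fin n) ℝ} {k : ℕ} {ι : Type*}
    (s : Finset ι) (g : ι → MvPolynomial (Fin n) ℝ) (hg : ∀ i ∈ s, g i ∈ handelmanCone f k) :
    ∑ i ∈ s, g i ∈ handelmanCone f k :=
  Finset.sum_induction g (· ∈ handelmanCone f k) (fun _ _ => add_mem_handelmanCone)
    (zero_mem_handelmanCone f k) hg

theorem C_mul_hPoly_mem_handelmanCone (f : Fin m → MvPolynomial (Fin n) ℝ) {k : ℕ} {a : ℝ}
    (ha : 0 ≤ a) {pq : (Fin m → ℕ) × (Fin m → ℕ)} (hpq : pq ∈ indexN m k) :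
    C a * hPoly f pq ∈ handelmanCone f k := by
  classical
  refine ⟨fun x => if x = pq then a else 0, fun x _ => by dsimp only; split_ifs <;> simp [ha], ?_⟩
  rw [Finset.sum_eq_single_of_mem pq hpq fun x _ hx => by simp [hx]]
  simp

theorem handelmanCone_mono (f : Fin m → MvPolynomial (Fin n) ℝ) {k k' : ℕ} (h : k ≤ k') :
    handelmanCone f k ⊆ handelmanCone f k' := by
  rintro _ ⟨c, hc, rfl⟩
  exact sum_mem_handelmanCone _ _ fun pq hpq => C_mul_hPoly_mem_handelmanCone f (hc pq hpq) <|
    (mem_indexN pq).mpr (((mem_indexN pq).mp hpq).trans h)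

theorem exists_aeval_mem_handelmanCone (f : Fin m → MvPolynomial (Fin n) ℝ)
    (F : MvPolynomial (Fin m) ℝ) (hF : ∀ y ∈ Set.Icc (0 : Fin m → ℝ) 1, 0 < eval y F) :
    ∃ k, aeval f F ∈ handelmanCone f k := by
  obtain ⟨N, hN, hpos⟩ := ((eventually_ge_atTop F.totalDegree).and
    (eventually_forall_bernsteinCoeff_nonneg F hF)).exists
  -- The product Bernstein monomial κ becomes h_{κ, N-κ}, whose exponents add up to mN.
  refine ⟨m * N, ?_⟩
  rw [aeval_eq_sum_bernsteinCoeff f F hN]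
  refine sum_mem_handelmanCone _ _ fun κ hκ => ?_
  have hκ : ∀ i, κ i ≤ N := fun i =>
    Nat.lt_succ_iff.mp (Finset.mem_range.mp (Fintype.mem_piFinset.mp hκ i))
  refine C_mul_hPoly_mem_handelmanCone f (pq := (κ, fun i => N - κ i))
    (mul_nonneg (hpos κ hκ) (by positivity)) ((mem_indexN _).mpr ?_)
  rw [← Finset.sum_add_distrib]
  simp [hκ]

/-- If `F` is positive on the common zeros in a compact set of the polynomials of an ideal, then
adding an element of the ideal makes it positive on the whole compact set. -/
theorem exists_mem_ideal_add_pos {σ : Type*} [Finite σ] (I : Ideal (MvPolynomial σ ℝ))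
    (F : MvPolynomial σ ℝ) {S : Set (σ → ℝ)} (hS : IsCompact S)
    (hF : ∀ y ∈ S, (∀ g ∈ I, eval y g = 0) → 0 < eval y F) :
    ∃ G ∈ I, ∀ y ∈ S, 0 < eval y (F + G) := by
  obtain ⟨T, hT⟩ := (isNoetherianRing_iff_ideal_fg _).mp inferInstance I
  -- This element of the ideal is nonnegative and vanishes exactly on the common zeros.
  set G : MvPolynomial σ ℝ := ∑ g ∈ T, g * g with hG
  have hGI : G ∈ I := I.sum_mem fun g hg =>
    I.mul_mem_left _ (hT ▸ Ideal.subset_span hg)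
  have hG0 : ∀ y, 0 ≤ eval y G := fun y => by
    rw [hG, map_sum]
    exact Finset.sum_nonneg fun g _ => by rw [map_mul]; exact mul_self_nonneg _
  have hGpos : ∀ y ∈ S, eval y F ≤ 0 → 0 < eval y G := by
    intro y hy hFy
    refine (hG0 y).lt_of_ne' fun h0 => hFy.not_gt (hF y hy fun g hg => ?_)
    rw [hG, map_sum, Finset.sum_eq_zero_iff_of_nonneg
      (fun g _ => by rw [map_mul]; exact mul_self_nonneg _)] at h0
    have : I ≤ RingHom.ker (eval y) := by
      rw [← hT, Ideal.span_le]
      exact fun g hg => by simpa using h0 g hg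
    exact this hg
  have hcompact : IsCompact (S ∩ {y | eval y F ≤ 0}) :=
    hS.inter_right (isClosed_le (MvPolynomial.continuous_eval F) continuous_const)
  rcases (S ∩ {y | eval y F ≤ 0}).eq_empty_or_nonempty with hempty | hne
  · refine ⟨0, I.zero_mem, fun y hy => ?_⟩
    by_contra hcon
    have : y ∈ S ∩ {y | eval y F ≤ 0} := ⟨hy, by simpa using hcon⟩
    simp [hempty] at this
  · obtain ⟨y₁, hy₁, hmin₁⟩ := hcompact.exists_isMinOn hne
      (MvPolynomial.continuous_eval G).continuousOn
    obtain ⟨y₂, hy₂, hmin₂⟩ := hcompact.exists_isMinOn hne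
      (MvPolynomial.continuous_eval F).continuousOn
    set δ := eval y₁ G
    have hδ : 0 < δ := hGpos y₁ hy₁.1 hy₁.2
    set M := eval y₂ F
    have hM : M ≤ 0 := hy₂.2
    -- Where F ≤ 0 one has F ≥ M and G ≥ δ, so the sum is at least 1; elsewhere in S, F is already
    -- positive.
    refine ⟨C ((1 - M) / δ) * G, I.mul_mem_left _ hGI, fun y hy => ?_⟩
    have hc : 0 < (1 - M) / δ := div_pos (by linarith) hδ
    rw [map_add, map_mul, eval_C]
    rcases le_or_gt (eval y F) 0 with hle | hgt
    · have h1 : δ ≤ eval y G := hmin₁ ⟨hy, hle⟩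
      have h2 : M ≤ eval y F := hmin₂ ⟨hy, hle⟩
      have h3 : (1 - M) / δ * δ ≤ (1 - M) / δ * eval y G := by gcongr
      rw [div_mul_cancel₀ _ hδ.ne'] at h3
      linarith
    · have := mul_nonneg hc.le (hG0 y)
      linarith

/-- Krivine's theorem: if `1, f₁, …, fₘ` generate the polynomial algebra, a polynomial positive on
`{x : 0 ≤ fᵢ(x) ≤ 1}` is a nonnegative combination of products of the `fᵢ` and `1 - fᵢ`. -/
theorem exists_mem_handelmanCone (f : Fin m → MvPolynomial (Fin n) ℝ)
    (hgen : Algebra.adjoin ℝ (insert 1 (Set.range f)) = ⊤) (g : MvPolynomial (Fin n) ℝ)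
    (hg : ∀ x ∈ feasibleSet f, 0 < eval x g) : ∃ k, g ∈ handelmanCone f k := by
  have hsurj : Function.Surjective (aeval (R := ℝ) f) := by
    rw [← AlgHom.range_eq_top, ← Algebra.adjoin_range_eq_range_aeval, eq_top_iff, ← hgen,
      Algebra.adjoin_le_iff, Set.insert_subset_iff]
    exact ⟨one_mem _, Algebra.subset_adjoin⟩
  choose z hz using fun j : Fin n => hsurj (X j)
  obtain ⟨F, rfl⟩ := hsurj g
  obtain ⟨G, hG, hpos⟩ := exists_mem_ideal_add_pos (RingHom.ker (aeval (R := ℝ) f)) F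
    (isCompact_Icc (a := (0 : Fin m → ℝ)) (b := 1)) (by
      intro y hy hker
      -- Since y annihilates the kernel, evaluation at y factors through the surjection and becomes
      -- evaluation at this x.
      set x : Fin n → ℝ := fun j => eval y (z j)
      have hcomp : ∀ H : MvPolynomial (Fin n) ℝ, ∀ P : MvPolynomial (Fin m) ℝ,
          aeval f P = H → eval x H = eval y P := by
        intro H P hP
        have h1 : aeval f (aeval z H) = H := by
          have : (aeval f).comp (aeval z) = AlgHom.id ℝ (MvPolynomial (Fin n) ℝ) := by
            ext j : 1
            rw [AlgHom.comp_apply, aeval_X, hz, AlgHom.id_apply]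
          exact DFunLike.congr_fun this H
        have h2 : eval y (aeval z H) = eval x H := by
          have : (aeval y).comp (aeval z) = aeval (R := ℝ) x := by
            ext j : 1
            simp [x, aeval_eq_eval]
          simpa [aeval_eq_eval] using DFunLike.congr_fun this H
        have h3 := hker (aeval z H - P) (by rw [RingHom.mem_ker, map_sub, h1, hP, sub_self])
        rw [map_sub, h2] at h3
        linarith
      rw [← hcomp _ F rfl]
      refine hg x fun i => ?_
      rw [hcomp (f i) (X i) (by simp), eval_X]
      exact ⟨hy.1 i, hy.2 i⟩)
  obtain ⟨k, hk⟩ := exists_aeval_mem_handelmanCone f (F + G) hpos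
  refine ⟨k, ?_⟩
  rwa [map_add, (RingHom.mem_ker).mp hG, add_zero] at hk

end SPLD

/-! ### Degrees of nonnegative polynomials. -/

/-- Otherwise q = o(p) and p = O(q) at infinity, so p = o(p), which is impossible for p ≠ 0. -/
theorem Polynomial.natDegree_le_of_forall_eval_le {p q : Polynomial ℝ} (h0 : ∀ t, 0 ≤ p.eval t)
    (h : ∀ t, p.eval t ≤ q.eval t) : p.natDegree ≤ q.natDegree := by
  by_contra! hlt
  have hp : p ≠ 0 := by
    rintro rfl
    simp at hlt
  have h1 := Polynomial.isLittleO_atTop_of_degree_lt _ _ (Polynomial.degree_lt_degree hlt)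
  have h2 : p.eval =O[atTop] q.eval := Asymptotics.isBigO_of_le _ fun t => by
    rw [Real.norm_eq_abs, Real.norm_eq_abs, abs_of_nonneg (h0 t)]
    exact (h t).trans (le_abs_self _)
  exact Asymptotics.isLittleO_irrefl
    (Polynomial.eventually_atTop_not_isRoot p hp).frequently (h2.trans_isLittleO h1)

theorem MvPolynomial.coeff_aeval_C_mul_X {σ : Type*} [Fintype σ] (q : MvPolynomial σ ℝ) (x : σ → ℝ)
    (k : ℕ) : (aeval (fun j => Polynomial.C (x j) * Polynomial.X) q : Polynomial ℝ).coeff k =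
      eval x (homogeneousComponent k q) := by
  induction q using MvPolynomial.induction_on' with
  | monomial u a =>
    rw [homogeneousComponent_of_mem ((mem_homogeneousSubmodule u.degree _).mpr
      (isHomogeneous_monomial a rfl)), aeval_monomial, Finsupp.prod_fintype _ _ (by simp)]
    simp_rw [mul_pow]
    rw [Finset.prod_mul_distrib, Finset.prod_pow_eq_pow_sum, ← Finsupp.degree_eq_sum]
    simp_rw [← Polynomial.C_pow]
    rw [← map_prod, Polynomial.algebraMap_eq, ← mul_assoc, ← Polynomial.C_mul,
      Polynomial.coeff_C_mul_X_pow]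
    split_ifs
    · rw [eval_monomial, Finsupp.prod_fintype _ _ (by simp)]
    · simp
  | add p q hp hq => simp only [map_add, Polynomial.coeff_add, hp, hq]

/-- Reduces to one variable by restriction to a line through the origin on which the top form of p
does not vanish. -/
theorem MvPolynomial.totalDegree_le_of_forall_eval_le {σ : Type*} [Fintype σ]
    {p q : MvPolynomial σ ℝ} (h0 : ∀ x, 0 ≤ eval x p) (h : ∀ x, eval x p ≤ eval x q) :
    p.totalDegree ≤ q.totalDegree := by
  rcases eq_or_ne p 0 with rfl | hp
  · simp
  have htop : homogeneousComponent p.totalDegree p ≠ 0 := by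
    obtain ⟨u, hu, hdeg⟩ := p.support.exists_mem_eq_sup (support_nonempty.mpr hp)
      (fun s => s.sum fun _ e => e)
    intro hzero
    have := congrArg (coeff u) hzero
    rw [coeff_homogeneousComponent, coeff_zero, if_pos, ← notMem_support_iff] at this
    · exact this hu
    · exact hdeg.symm
  obtain ⟨x, hx⟩ : ∃ x, eval x (homogeneousComponent p.totalDegree p) ≠ 0 := by
    by_contra! hcon
    exact htop (MvPolynomial.funext fun x => by rw [hcon, map_zero])
  have heval : ∀ (r : MvPolynomial σ ℝ) (t : ℝ),
      (aeval (fun j => Polynomial.C (x j) * Polynomial.X) r : Polynomial ℝ).eval t =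
        eval (fun j => x j * t) r := by
    intro r t
    have : (Polynomial.aeval t).comp
        (aeval (fun j => Polynomial.C (x j) * Polynomial.X)) =
        aeval (R := ℝ) fun j => x j * t := by
      ext j : 1
      simp
    simpa [aeval_eq_eval, Polynomial.coe_aeval_eq_eval] using DFunLike.congr_fun this r
  have hle := Polynomial.natDegree_le_of_forall_eval_le
    (p := aeval (fun j => Polynomial.C (x j) * Polynomial.X) p)
    (q := aeval (fun j => Polynomial.C (x j) * Polynomial.X) q)
    (fun t => by rw [heval]; exact h0 _) (fun t => by rw [heval, heval]; exact h _)
  refine (Polynomial.le_natDegree_of_ne_zero ?_).trans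
    (hle.trans (Polynomial.natDegree_le_iff_coeff_eq_zero.mpr fun k hk => ?_))
  · rwa [coeff_aeval_C_mul_X]
  · rw [coeff_aeval_C_mul_X, homogeneousComponent_eq_zero _ _ hk, map_zero]

/-! ### Weak duality and point evaluations. -/

namespace SPLD

variable {n m : ℕ}

/-- The Riesz functional as a linear map. -/
noncomputable def rieszLinear {D : ℕ} (y : multiIndices n D → ℝ) : MvPolynomial (Fin n) ℝ →ₗ[ℝ] ℝ where
  toFun := riesz y
  map_add' g h := by simp [riesz, add_mul, Finset.sum_add_distrib]
  map_smul' a g := by simp [riesz, Finset.mul_sum, mul_assoc]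

theorem rieszLinear_apply {D : ℕ} (y : multiIndices n D → ℝ) (g : MvPolynomial (Fin n) ℝ) :
    rieszLinear y g = riesz y g := rfl

theorem momentMatrix_apply {D : ℕ} {ι : Type} (y : multiIndices n D → ℝ)
    (v : ι → MvPolynomial (Fin n) ℝ) (a b : ι) :
    momentMatrix y v a b = riesz y (v a * v b) := by
  simp only [momentMatrix, riesz, Matrix.sum_apply, Matrix.smul_apply, Matrix.of_apply, smul_eq_mul]
  exact Finset.sum_congr rfl fun α _ => mul_comm _ _

theorem riesz_mul_self_nonneg {D : ℕ} {ι : Type} [Fintype ι] {y : multiIndices n D → ℝ}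
    {v : ι → MvPolynomial (Fin n) ℝ} (hv : (momentMatrix y v).PosSemidef) (c : ι → ℝ) :
    0 ≤ riesz y ((∑ a, c a • v a) * ∑ a, c a • v a) := by
  have h := hv.dotProduct_mulVec_nonneg c
  have : riesz y ((∑ a, c a • v a) * ∑ a, c a • v a) =
      star c ⬝ᵥ Matrix.mulVec (momentMatrix y v) c := by
    rw [← rieszLinear_apply, Finset.sum_mul_sum, map_sum]
    simp only [dotProduct, Matrix.mulVec, star_trivial, momentMatrix_apply, Finset.mul_sum, map_sum]
    refine Finset.sum_congr rfl fun a _ => Finset.sum_congr rfl fun b _ => ?_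
    rw [smul_mul_smul_comm, map_smul, rieszLinear_apply, smul_eq_mul]
    ring
  rwa [this]

theorem eq_sum_monomialVec {r : ℕ} {g : MvPolynomial (Fin n) ℝ} (hg : g.totalDegree ≤ r) :
    g = ∑ β : multiIndices n r, coeff β.1 g • monomialVec n r β := by
  have hsub : g.support ⊆ multiIndices n r := fun α hα => (mem_multiIndices α).mpr <| by
    have := le_totalDegree hα
    rw [Finsupp.sum_fintype _ _ (by simp)] at this
    exact this.trans hg
  simp only [monomialVec]
  rw [Finset.sum_coe_sort (multiIndices n r) fun β => coeff β g • monomial β (1 : ℝ),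
    ← Finset.sum_subset hsub]
  · conv_lhs => rw [g.as_sum]
    simp [smul_monomial]
  · intro α _ hα
    rw [notMem_support_iff.mp hα, zero_smul]

theorem aeval_X_eq_sum_monomialVecUni (j : Fin n) {e : ℕ} {g : Polynomial ℝ}
    (hg : g.natDegree ≤ e) : Polynomial.aeval (X j : MvPolynomial (Fin n) ℝ) g =
      ∑ a : Fin (e + 1), g.coeff a • monomialVecUni j e a := by
  rw [Polynomial.aeval_eq_sum_range' (Nat.lt_succ_of_le hg), Finset.sum_range]
  rfl

theorem eval_nonneg_of_isSumSq {σ : MvPolynomial (Fin n) ℝ} (h : IsSumSq σ) (x : Fin n → ℝ) :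
    0 ≤ eval x σ := by
  induction h with
  | zero => simp
  | sq_add a _ ih => rw [map_add, map_mul]; exact add_nonneg (mul_self_nonneg _) ih

theorem polynomial_eval_nonneg_of_isSumSq {τ : Polynomial ℝ} (h : IsSumSq τ) (t : ℝ) :
    0 ≤ τ.eval t := by
  induction h with
  | zero => simp
  | sq_add a _ ih =>
    rw [Polynomial.eval_add, Polynomial.eval_mul]; exact add_nonneg (mul_self_nonneg _) ih

/-- The degree bound is imposed on the whole sum, but leading terms of squares cannot cancel. Hence
each root has degree at most r and is a combination of the entries of the monomial vector. -/
theorem riesz_nonneg_of_mem_sosSet {D r : ℕ} {y : multiIndices n D → ℝ}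
    (hy : (momentMatrix y (monomialVec n r)).PosSemidef) {σ : MvPolynomial (Fin n) ℝ}
    (hσ : σ ∈ sosSet n r) : 0 ≤ riesz y σ := by
  obtain ⟨hσ, hdeg⟩ := hσ
  induction hσ with
  | zero => simp [riesz]
  | @sq_add a s hs ih =>
    have hs0 := eval_nonneg_of_isSumSq hs
    have h1 : (a * a).totalDegree ≤ (a * a + s).totalDegree :=
      totalDegree_le_of_forall_eval_le (fun x => by rw [map_mul]; exact mul_self_nonneg _)
        fun x => by rw [map_add]; linarith [hs0 x]
    have h2 : s.totalDegree ≤ (a * a + s).totalDegree :=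
      totalDegree_le_of_forall_eval_le hs0
        fun x => by rw [map_add, map_mul]; linarith [mul_self_nonneg (eval x a)]
    have ha : a.totalDegree ≤ r := by
      rcases eq_or_ne a 0 with rfl | ha
      · simp
      · rw [totalDegree_mul_of_isDomain ha ha] at h1
        omega
    rw [← rieszLinear_apply, map_add]
    refine add_nonneg ?_ (ih (h2.trans hdeg))
    rw [eq_sum_monomialVec ha]
    exact riesz_mul_self_nonneg hy _

theorem riesz_nonneg_of_mem_sosSetUni {D e : ℕ} {y : multiIndices n D → ℝ} (j : Fin n)
    (hy : (momentMatrix y (monomialVecUni j e)).PosSemidef) {τ : Polynomial ℝ}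
    (hτ : τ ∈ sosSetUni e) : 0 ≤ riesz y (Polynomial.aeval (X j : MvPolynomial (Fin n) ℝ) τ) := by
  obtain ⟨hτ, hdeg⟩ := hτ
  induction hτ with
  | zero => simp [riesz]
  | @sq_add a s hs ih =>
    have hs0 := polynomial_eval_nonneg_of_isSumSq hs
    have h1 : (a * a).natDegree ≤ (a * a + s).natDegree :=
      Polynomial.natDegree_le_of_forall_eval_le
        (fun x => by rw [Polynomial.eval_mul]; exact mul_self_nonneg _)
        fun x => by rw [Polynomial.eval_add]; linarith [hs0 x]
    have h2 : s.natDegree ≤ (a * a + s).natDegree :=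
      Polynomial.natDegree_le_of_forall_eval_le hs0 fun x => by
        rw [Polynomial.eval_add, Polynomial.eval_mul]
        linarith [mul_self_nonneg (a.eval x)]
    have ha : a.natDegree ≤ e := by
      rcases eq_or_ne a 0 with rfl | ha
      · simp
      · rw [Polynomial.natDegree_mul ha ha] at h1
        omega
    rw [map_add, map_mul, ← rieszLinear_apply, map_add]
    refine add_nonneg ?_ (ih (h2.trans hdeg))
    rw [aeval_X_eq_sum_monomialVecUni j ha]
    exact riesz_mul_self_nonneg hy _

theorem riesz_one {D : ℕ} {y : multiIndices n D → ℝ}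
    (hy : ∀ α : multiIndices n D, α.1 = 0 → y α = 1) : riesz y 1 = 1 := by
  classical
  have h0 : (0 : Fin n →₀ ℕ) ∈ multiIndices n D := (mem_multiIndices _).mpr (by simp)
  rw [riesz, Finset.sum_eq_single ⟨0, h0⟩]
  · rw [hy _ rfl, coeff_zero_one, mul_one]
  · intro α _ hα
    have : α.1 ≠ 0 := fun h => hα (Subtype.ext h)
    rw [coeff_one, if_neg this.symm, zero_mul]
  · simp

theorem valSOS_le_valMoment (f₀ : MvPolynomial (Fin n) ℝ) (f : Fin m → MvPolynomial (Fin n) ℝ)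
    (d : Fin n → ℕ) (r k : ℕ) : valSOS f₀ f d r k ≤ valMoment f₀ f d r k := by
  refine iSup₂_le fun μ hμ => le_iInf₂ fun y hy => EReal.coe_le_coe_iff.mpr ?_
  obtain ⟨c, σ, τ, hc, hσ, hτ, heq⟩ := hμ
  have h := congrArg (rieszLinear y) heq
  have hC : (C μ : MvPolynomial (Fin n) ℝ) = μ • 1 := by
    rw [MvPolynomial.smul_eq_C_mul, mul_one]
  simp only [map_sub, map_add, map_sum, ← MvPolynomial.smul_eq_C_mul, hC, map_smul,
    rieszLinear_apply, riesz_one hy.normalized, smul_eq_mul, mul_one] at h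
  have h1 : 0 ≤ ∑ pq ∈ indexN m k, c pq * riesz y (hPoly f pq) :=
    Finset.sum_nonneg fun pq hpq => mul_nonneg (hc pq hpq) (hy.riesz_nonneg pq hpq)
  have h2 := riesz_nonneg_of_mem_sosSet hy.posSemidef hσ
  have h3 : 0 ≤ ∑ j, riesz y (Polynomial.aeval (X j : MvPolynomial (Fin n) ℝ) (τ j)) :=
    Finset.sum_nonneg fun j _ => riesz_nonneg_of_mem_sosSetUni j (hy.posSemidef_uni j) (hτ j)
  linarith

/-- The moments of the Dirac measure at `x`. -/
def diracMoments (D : ℕ) (x : Fin n → ℝ) : multiIndices n D → ℝ :=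
  fun α => ∏ j, x j ^ α.1 j

theorem riesz_diracMoments {D : ℕ} (x : Fin n → ℝ) {g : MvPolynomial (Fin n) ℝ}
    (hg : g.totalDegree ≤ D) : riesz (diracMoments D x) g = eval x g := by
  conv_rhs => rw [eq_sum_monomialVec hg]
  rw [map_sum, riesz]
  refine Finset.sum_congr rfl fun α _ => ?_
  rw [monomialVec, smul_eval, eval_monomial, one_mul, Finsupp.prod_fintype _ _ (by simp),
    diracMoments]

/-- The truncation keeps every needed moment, so the matrix is the rank-one matrix v(x)v(x)ᵀ. -/
theorem momentMatrix_diracMoments_posSemidef {D : ℕ} {ι : Type} [Fintype ι] (x : Fin n → ℝ)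
    {v : ι → MvPolynomial (Fin n) ℝ} {e : ℕ} (hv : ∀ a, (v a).totalDegree ≤ e) (he : 2 * e ≤ D) :
    (momentMatrix (diracMoments D x) v).PosSemidef := by
  have : momentMatrix (diracMoments D x) v =
      Matrix.vecMulVec (fun a => eval x (v a)) (star fun a => eval x (v a)) := by
    ext a b
    have hdeg : (v a * v b).totalDegree ≤ D := by
      have := totalDegree_mul (v a) (v b)
      have := hv a
      have := hv b
      omega
    rw [momentMatrix_apply, riesz_diracMoments x hdeg, map_mul, Matrix.vecMulVec_apply,
      Pi.star_apply, star_trivial]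
  rw [this]
  exact Matrix.posSemidef_vecMulVec_self_star _

theorem totalDegree_hPoly_le (f : Fin m → MvPolynomial (Fin n) ℝ) {k : ℕ}
    {pq : (Fin m → ℕ) × (Fin m → ℕ)} (hpq : pq ∈ indexN m k) :
    (hPoly f pq).totalDegree ≤ k * Finset.univ.sup fun i => (f i).totalDegree := by
  set M := Finset.univ.sup fun i => (f i).totalDegree
  have hM : ∀ i, (f i).totalDegree ≤ M := fun i =>
    Finset.le_sup (f := fun i => (f i).totalDegree) (Finset.mem_univ i)
  have hM' : ∀ i, (1 - f i).totalDegree ≤ M := fun i =>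
    (totalDegree_sub _ _).trans (by simpa using hM i)
  calc (hPoly f pq).totalDegree ≤ ∑ i, (pq.1 i * M + pq.2 i * M) := by
        refine (totalDegree_finsetProd _ _).trans (Finset.sum_le_sum fun i _ => ?_)
        refine (totalDegree_mul _ _).trans (add_le_add ?_ ?_)
        · exact (totalDegree_pow _ _).trans (Nat.mul_le_mul_left _ (hM i))
        · exact (totalDegree_pow _ _).trans (Nat.mul_le_mul_left _ (hM' i))
    _ = (∑ i, pq.1 i + ∑ i, pq.2 i) * M := by
        rw [Finset.sum_add_distrib, ← Finset.sum_mul, ← Finset.sum_mul, add_mul]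
    _ ≤ k * M := Nat.mul_le_mul_right _ ((mem_indexN pq).mp hpq)

theorem max_totalDegree_le_two_mul_dMax (f₀ : MvPolynomial (Fin n) ℝ)
    (f : Fin m → MvPolynomial (Fin n) ℝ) (k : ℕ) :
    max f₀.totalDegree (k * Finset.univ.sup fun i => (f i).totalDegree) ≤ 2 * dMax f₀ f k := by
  -- A member must be exhibited, as `sInf` of an empty set of naturals would be 0; the added 1
  -- ensures positivity.
  refine (Nat.sInf_mem (s := {e : ℕ | 0 < e ∧
    max f₀.totalDegree (k * Finset.univ.sup fun i => (f i).totalDegree) ≤ 2 * e})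
    ⟨max f₀.totalDegree (k * Finset.univ.sup fun i => (f i).totalDegree) + 1, ?_⟩).2
  constructor <;> omega

theorem eval_hPoly_nonneg {f : Fin m → MvPolynomial (Fin n) ℝ} {x : Fin n → ℝ}
    (hx : x ∈ feasibleSet f) (pq : (Fin m → ℕ) × (Fin m → ℕ)) : 0 ≤ eval x (hPoly f pq) := by
  rw [hPoly, map_prod]
  refine Finset.prod_nonneg fun i _ => ?_
  rw [map_mul, map_pow, map_pow, map_sub, map_one]
  exact mul_nonneg (pow_nonneg (hx i).1 _) (pow_nonneg (sub_nonneg.mpr (hx i).2) _)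

theorem valMoment_le_valP (f₀ : MvPolynomial (Fin n) ℝ) (f : Fin m → MvPolynomial (Fin n) ℝ)
    (d : Fin n → ℕ) (r k : ℕ) : valMoment f₀ f d r k ≤ valP f₀ f := by
  refine le_iInf₂ fun x hx => ?_
  have hmax := max_totalDegree_le_two_mul_dMax f₀ f k
  have h1 : dMax f₀ f k ≤ truncOrder f₀ f d r k := le_max_left _ _
  have h2 : r ≤ truncOrder f₀ f d r k := (le_max_left _ _).trans (le_max_right _ _)
  have h3 : ∀ j, d j ≤ truncOrder f₀ f d r k := fun j =>
    (Finset.le_sup (Finset.mem_univ j)).trans ((le_max_right _ _).trans (le_max_right _ _))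
  refine iInf₂_le_of_le (diracMoments _ x) ⟨fun pq hpq => ?_, fun j => ?_, ?_, fun α hα => ?_⟩
    (EReal.coe_le_coe_iff.mpr (riesz_diracMoments x ?_).le)
  · rw [riesz_diracMoments x]
    · exact eval_hPoly_nonneg hx pq
    · have := totalDegree_hPoly_le f hpq
      omega
  · refine momentMatrix_diracMoments_posSemidef x (e := d j) (fun a => ?_)
      (Nat.mul_le_mul_left 2 (h3 j))
    rw [monomialVecUni, totalDegree_X_pow]
    exact Nat.lt_succ_iff.mp a.2
  · refine momentMatrix_diracMoments_posSemidef x (e := r) (fun β => ?_) (Nat.mul_le_mul_left 2 h2)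
    rw [monomialVec, totalDegree_monomial _ one_ne_zero, Finsupp.sum_fintype _ _ (by simp)]
    exact (mem_multiIndices _).mp β.2
  · simp [diracMoments, hα]
  · omega

/-! ### Convergence of the relaxations. -/

theorem isFeasibleSOS_of_mem_handelmanCone {f₀ : MvPolynomial (Fin n) ℝ}
    {f : Fin m → MvPolynomial (Fin n) ℝ} (d : Fin n → ℕ) (r : ℕ) {k : ℕ} {μ : ℝ}
    (h : f₀ - C μ ∈ handelmanCone f k) : IsFeasibleSOS f₀ f d r k μ := by
  obtain ⟨c, hc, heq⟩ := h
  refine ⟨c, 0, 0, hc, ⟨IsSumSq.zero, by simp⟩, fun j => ⟨IsSumSq.zero, by simp⟩, ?_⟩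
  rw [sub_right_comm, heq]
  simp

theorem eventually_coe_le_valSOS (f₀ : MvPolynomial (Fin n) ℝ)
    (f : Fin m → MvPolynomial (Fin n) ℝ) (hgen : Algebra.adjoin ℝ (insert 1 (Set.range f)) = ⊤)
    (d : Fin n → ℕ) (r : ℕ) {μ : ℝ} (hμ : (μ : EReal) < valP f₀ f) :
    ∀ᶠ k in atTop, (μ : EReal) ≤ valSOS f₀ f d r k := by
  obtain ⟨k₀, hk₀⟩ := exists_mem_handelmanCone f hgen (f₀ - C μ) fun x hx => by
    rw [map_sub, eval_C, sub_pos, ← EReal.coe_lt_coe_iff]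
    exact hμ.trans_le (iInf₂_le x hx)
  filter_upwards [eventually_ge_atTop k₀] with k hk
  exact le_iSup₂_of_le μ
    (isFeasibleSOS_of_mem_handelmanCone d r (handelmanCone_mono f hk hk₀)) le_rfl

end SPLD

theorem mainTheorem1 {n m : ℕ} (f₀ : MvPolynomial (Fin n) ℝ) (f : Fin m → MvPolynomial (Fin n) ℝ)
    (hf₀ : SPLD.IsSPLD f₀) (hf : ∀ i, SPLD.IsSPLD (f i))
    (hK : IsCompact (SPLD.feasibleSet f)) (hKne : (SPLD.feasibleSet f).Nonempty)
    (hgen : Algebra.adjoin ℝ (insert 1 (Set.range f)) = ⊤)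
    (d : Fin n → ℕ) (r : ℕ) :
    (∀ k : ℕ, SPLD.valSOS f₀ f d r k ≤ SPLD.valMoment f₀ f d r k ∧
      SPLD.valMoment f₀ f d r k ≤ SPLD.valP f₀ f) ∧
    Tendsto (fun k : ℕ => SPLD.valSOS f₀ f d r k) atTop (𝓝 (SPLD.valP f₀ f)) ∧
    Tendsto (fun k : ℕ => SPLD.valMoment f₀ f d r k) atTop (𝓝 (SPLD.valP f₀ f)) := by
  have h1 := SPLD.valSOS_le_valMoment f₀ f d r
  have h2 := SPLD.valMoment_le_valP f₀ f d r
  have hlim : Tendsto (fun k : ℕ => SPLD.valSOS f₀ f d r k) atTop (𝓝 (SPLD.valP f₀ f)) := by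
    refine tendsto_order.mpr ⟨fun a ha => ?_, fun b hb =>
      Eventually.of_forall fun k => ((h1 k).trans (h2 k)).trans_lt hb⟩
    -- The bound `a` may be -∞, whereas feasible values are real.
    obtain ⟨μ, haμ, hμ⟩ := EReal.lt_iff_exists_real_btwn.mp ha
    filter_upwards [SPLD.eventually_coe_le_valSOS f₀ f hgen d r hμ] with k hk
    exact haμ.trans_le hk
  exact ⟨fun k => ⟨h1 k, h2 k⟩, hlim,
    tendsto_of_tendsto_of_tendsto_of_le_of_le hlim tendsto_const_nhds h1 h2⟩
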